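/- A finite chain ring is a finite nonzero commutative ring with identity whose ideals form a chain under inclusion. Let $R,R'$ be finite chain rings with a surjective ring homomorphism $\rho:R\to R'$. Let $\ell,\ell'$ be the nilpotency indices of the radicals of $R,R'$ (the least $\ell\ge 1$ with $J(R)^{\ell}=0$, and likewise $\ell'$ for $R'$), and let $q$ be the cardinality of the residue field $F$ of $R$ (which is also the residue field of $R'$). Let $\lambda\in R^\times$, put $\lambda'=\rho(\lambda)$, and let $t$ be the order of the residue image of $\lambda$ in $F^\times$. Let $\alpha,\alpha'$ be positive integers with $\alpha\equiv\alpha'\pmod t$ and $\gcd(\alpha,t)=1$. For an integer $n>0$, an $(R',R)$-linear $(\lambda',\lambda)$-constacyclic code of cycle length $(\alpha' n,\alpha n)$ is an $R[X]$-submodule $C$ of $$\big(R'[X]/\langle X^{\alpha' n}-\lambda'\rangle\big)\times\big(R[X]/\langle X^{\alpha n}-\lambda\rangle\big),$$ where $R[X]$ acts on the first factor through $\rho$ applied to coefficients. Each element of a factor is represented by its unique polynomial of degree less than $\alpha' n$, respectively $\alpha n$; the Hamming weight of a pair is the total number of nonzero coefficients of its two representatives, and $\mathrm{w}(C)$ is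 the minimum Hamming weight of the nonzero elements of $C$ (with $\mathrm w(0)=0$). The code length, rate and relative minimum distance of $C$ are $$L(C)=\alpha' n\ell'+\alpha n\ell,\qquad \mathrm R(C)=\frac{\log_q|C|}{L(C)},\qquad \Delta(C)=\frac{\mathrm w(C)}{L(C)}.$$ Then there are positive integers $n_1,n_2,\dots$ and, for each $i$, an $(R',R)$-linear $(\lambda',\lambda)$-constacyclic code $C_i$ of cycle length $(\alpha' n_i,\alpha n_i)$ such that the sequence $C_1,C_2,\dots$ is asymptotically good: $L(C_i)\to\infty$ (equivalently $n_i\to\infty$), and there is a real number $\delta>0$ with $\mathrm R(C_i)\ge\delta$ and $\Delta(C_i)\ge\delta$ for all $i$. -/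

import Mathlib

open Polynomial Filter

/-- A finite commutative chain ring: a finite nonzero commutative ring whose ideals form a chain
with respect to inclusion. -/
class IsFiniteChainRing (R : Type*) [CommRing R] : Prop where
  finite : Finite R
  nontrivial : Nontrivial R
  ideal_total : ∀ I J : Ideal R, I ≤ J ∨ J ≤ I

namespace IsFiniteChainRing

theorem isLocalRing (R : Type*) [CommRing R] [h : IsFiniteChainRing R] : IsLocalRing R := by
  have := h.nontrivial
  refine ⟨fun {a b} hab => ?_⟩
  rcases h.ideal_total (Ideal.span {a}) (Ideal.span {b}) with hle | hle
  · right
    have hd : b ∣ a := Ideal.span_singleton_le_span_singleton.1 hle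
    exact isUnit_of_dvd_one (hab ▸ dvd_add hd dvd_rfl)
  · left
    have hd : a ∣ b := Ideal.span_singleton_le_span_singleton.1 hle
    exact isUnit_of_dvd_one (hab ▸ dvd_add dvd_rfl hd)

instance (R : Type*) [CommRing R] [IsFiniteChainRing R] : IsLocalRing R := isLocalRing R

end IsFiniteChainRing

/-- The nilpotency index `ℓ` of the radical `J` of a finite chain ring: the least `ℓ` with
`J ^ ℓ = 0`. -/
noncomputable def radicalNilpotencyIndex (R : Type*) [CommRing R] [IsFiniteChainRing R] : ℕ :=
  nilpotencyClass (IsLocalRing.maximalIdeal R)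

/-- The order of the residue image of a unit `a` in the unit group of the residue field. -/
noncomputable def residueOrder {R : Type*} [CommRing R] [IsFiniteChainRing R] (a : Rˣ) : ℕ :=
  orderOf (Units.map (IsLocalRing.residue R : R →* IsLocalRing.ResidueField R) a)

/-- The quotient ring `R[X] / ⟨X ^ m - a⟩`. -/
abbrev ConstacyclicRing {R : Type*} [CommRing R] (a : R) (m : ℕ) : Type _ :=
  R[X] ⧸ Ideal.span {X ^ m - C a}

/-- The Hamming weight of an element of `R[X] / ⟨X ^ m - a⟩`, for `m > 0`: the number of nonzero
coefficients of its unique representative of degree less than `m`, which is obtained from any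
representative as the remainder of division by `X ^ m - a`. -/
noncomputable def ConstacyclicRing.weight {R : Type*} [CommRing R] {a : R} {m : ℕ}
    (c : ConstacyclicRing a m) : ℕ :=
  (Quotient.out c %ₘ (X ^ m - C a)).support.card

theorem ConstacyclicRing.weight_mk {R : Type*} [CommRing R] {a : R} {m : ℕ} (hm : m ≠ 0)
    (p : R[X]) (hp : p.degree < m) :
    ConstacyclicRing.weight (Ideal.Quotient.mk (Ideal.span {X ^ m - C a}) p) = p.support.card := by
  cases subsingleton_or_nontrivial R
  · simp [ConstacyclicRing.weight, Subsingleton.elim _ (0 : R[X])]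
  have hmon : (X ^ m - C a : R[X]).Monic := monic_X_pow_sub_C a hm
  have hdvd : X ^ m - C a ∣
      Quotient.out (Ideal.Quotient.mk (Ideal.span {X ^ m - C a}) p) - p := by
    rw [← Ideal.mem_span_singleton, ← Ideal.Quotient.eq]
    exact Quotient.out_eq _
  have h0 := (modByMonic_eq_zero_iff_dvd hmon).2 hdvd
  rw [sub_modByMonic, sub_eq_zero] at h0
  rw [ConstacyclicRing.weight, h0, (modByMonic_eq_self_iff hmon).2]
  rwa [degree_X_pow_sub_C (Nat.pos_of_ne_zero hm)]

/-- The ring `S[X] / ⟨X ^ m - b⟩`, regarded as an `R[X]`-module through `ρ : R → S`. -/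
def ConstacyclicModule {R S : Type*} [CommRing R] [CommRing S] (_ρ : R →+* S) (b : S) (m : ℕ) :
    Type _ :=
  ConstacyclicRing b m

namespace ConstacyclicModule

variable {R S : Type*} [CommRing R] [CommRing S] (ρ : R →+* S) (b : S) (m : ℕ)

noncomputable instance : AddCommGroup (ConstacyclicModule ρ b m) :=
  inferInstanceAs (AddCommGroup (ConstacyclicRing b m))

/-- The polynomial `∑ aᵢ Xⁱ` over `R` acts as multiplication by `∑ ρ(aᵢ) Xⁱ`. -/
noncomputable instance : Module R[X] (ConstacyclicModule ρ b m) :=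
  Module.compHom (ConstacyclicRing b m) (Polynomial.mapRingHom ρ)

end ConstacyclicModule

/-- The `R[X]`-module `(R'[X] / ⟨X ^ (α' n) - ρ(a)⟩) × (R[X] / ⟨X ^ (α n) - a⟩)`. -/
abbrev DoubleConstacyclicSpace {R R' : Type*} [CommRing R] [CommRing R'] (ρ : R →+* R') (a : R)
    (α' α n : ℕ) : Type _ :=
  ConstacyclicModule ρ (ρ a) (α' * n) × ConstacyclicRing a (α * n)

/-- The `(R', R)`-linear `(ρ(a), a)`-constacyclic codes of cycle length `(α' n, α n)`: the
`R[X]`-submodules of `(R'[X] / ⟨X ^ (α' n) - ρ(a)⟩) × (R[X] / ⟨X ^ (α n) - a⟩)`. -/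
abbrev DoubleConstacyclicCode {R R' : Type*} [CommRing R] [CommRing R'] (ρ : R →+* R') (a : R)
    (α' α n : ℕ) : Type _ :=
  Submodule R[X] (DoubleConstacyclicSpace ρ a α' α n)

namespace DoubleConstacyclicCode

/-- The Hamming weight of a word: the sum of the weights of its two components. -/
noncomputable def wordWeight {R R' : Type*} [CommRing R] [CommRing R'] {ρ : R →+* R'} {a : R}
    {α' α n : ℕ} (c : DoubleConstacyclicSpace ρ a α' α n) : ℕ :=
  ConstacyclicRing.weight (a := ρ a) (m := α' * n) c.1 + ConstacyclicRing.weight c.2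

/-- The minimum Hamming weight of the nonzero words of a code (`0` for the zero code). -/
noncomputable def minWeight {R R' : Type*} [CommRing R] [CommRing R'] {ρ : R →+* R'} {a : R}
    {α' α n : ℕ} (C : DoubleConstacyclicCode ρ a α' α n) : ℕ :=
  sInf {w : ℕ | ∃ c ∈ C, c ≠ 0 ∧ wordWeight c = w}

/-- The code length `α' n ℓ' + α n ℓ`, where `ℓ'` and `ℓ` are the nilpotency indices of the
radicals of `R'` and `R`. -/
noncomputable def codeLength (R R' : Type*) [CommRing R] [CommRing R'] [IsFiniteChainRing R]
    [IsFiniteChainRing R'] (α' α n : ℕ) : ℕ :=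
  α' * n * radicalNilpotencyIndex R' + α * n * radicalNilpotencyIndex R

/-- The rate `log_q |C| / (α' n ℓ' + α n ℓ)`, where `q` is the cardinality of the residue
field. -/
noncomputable def rate {R R' : Type*} [CommRing R] [CommRing R'] [IsFiniteChainRing R]
    [IsFiniteChainRing R'] {ρ : R →+* R'} {a : R} {α' α n : ℕ}
    (C : DoubleConstacyclicCode ρ a α' α n) : ℝ :=
  Real.logb (Nat.card (IsLocalRing.ResidueField R)) (Nat.card C) / codeLength R R' α' α n

/-- The relative minimum distance `w(C) / (α' n ℓ' + α n ℓ)`. -/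
noncomputable def relMinDistance {R R' : Type*} [CommRing R] [CommRing R'] [IsFiniteChainRing R]
    [IsFiniteChainRing R'] {ρ : R →+* R'} {a : R} {α' α n : ℕ}
    (C : DoubleConstacyclicCode ρ a α' α n) : ℝ :=
  (minWeight C : ℝ) / codeLength R R' α' α n

/-- A sequence of codes of cycle lengths `(α' nᵢ, α nᵢ)` is asymptotically good if the code length
goes to infinity and the rates and the relative minimum distances are bounded below by a positive
real number. -/
def AsymptoticallyGood {R R' : Type*} [CommRing R] [CommRing R'] [IsFiniteChainRing R]
    [IsFiniteChainRing R'] {ρ : R →+* R'} {a : R} {α' α : ℕ} {n : ℕ → ℕ}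
    (C : ∀ i, DoubleConstacyclicCode ρ a α' α (n i)) : Prop :=
  Tendsto (fun i => codeLength R R' α' α (n i)) atTop atTop ∧
    ∃ δ : ℝ, 0 < δ ∧ ∀ i, δ ≤ rate (C i) ∧ δ ≤ relMinDistance (C i)

end DoubleConstacyclicCode

/-!
Asymptotically good double constacyclic codes exist because, for suitable lengths, both factors of
the ambient space contain one and the same simple `R[X]`-module, and this module is so large that a
counting argument finds a good code among its embeddings.

Let `F` be the residue field and `u` the residue of `λ`. The congruence and coprimality conditions
give `v ∈ Fˣ` with `v ^ α = v ^ α' = u`. Choose a finite extension `E` of `F` whose unit group has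
order divisible by an odd prime `r`, a generator `g` of `Eˣ`, and `N > 0` with `g ^ N = v`. As `g` is
not an `r`-th power, `X ^ (r ^ i) - g` is irreducible over `E` for every `i`. A root `b` of it
satisfies `b ^ (α n) = b ^ (α' n) = u` for `n = N r ^ i`, and its degree over `F` is at least
`r ^ i = n / N`, a fixed fraction of `n` (`exists_high_degree_root`).

Let `P` be the kernel of the evaluation `R[X] → F(b)`, so that `R[X] / P` has `q ^ deg b` elements.
Each factor of the ambient space is a finite ring mapping to `F(b)`. In a finite ring every prime is
associated, so each factor has an element, `e'` respectively `e`, with annihilator exactly `P`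
(`exists_smul_eq_zero_iff_mem_ker`). The submodules generated by `(e', f e)`, for `f` running
through `R[X] / P`, all have `q ^ deg b` elements and meet pairwise in `0`. A set `S` of fewer than
`q ^ deg b` words therefore misses the nonzero part of one of them
(`exists_submodule_disjoint_of_ncard_lt`). For `S` take the words of weight at most `ε r ^ i`. A
Chernoff bound (`DoubleConstacyclicCode.ncard_wordWeight_le`) shows that there are fewer than
`2 ^ (r ^ i)` of them when the constant `ε` is small enough, independently of `i`.
-/

/-! ### Codes avoiding a small set of words -/


theorem exists_annihilator_eq_prime (B : Type*) [CommRing B] [Finite B] (P : Ideal B) [P.IsPrime] :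
    ∃ e : B, ∀ f : B, f * e = 0 ↔ f ∈ P := by
  have : P.IsMaximal := IsArtinianRing.isMaximal_of_isPrime P
  have : IsFractionRing B B := 
    IsLocalization.self (IsArtinianRing.isUnitSubmonoid_eq (R := B)).ge
  have hP : IsAssociatedPrime P B := Ideal.IsMaximal.mem_associatedPrimes_of_isFractionRing B P
  obtain ⟨-, e, he⟩ := isAssociatedPrime_iff.1 hP
  refine ⟨e, fun f => ?_⟩
  rw [he, Submodule.mem_colon_singleton]
  simp

/-- If `e'` and `e` both have annihilator the prime `P`, the submodules generated by `(e', a • e)`,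
with `a` modulo `P`, meet pairwise in `0`; hence fewer than `|A / P|` words cannot meet all of them
outside `0`. -/
theorem exists_submodule_disjoint_of_ncard_lt {A M M' : Type*} [CommRing A] [AddCommGroup M]
    [AddCommGroup M'] [Module A M] [Module A M'] (P : Ideal A) [P.IsPrime] {e' : M'} {e : M}
    (he' : ∀ f : A, f • e' = 0 ↔ f ∈ P) (he : ∀ f : A, f • e = 0 ↔ f ∈ P)
    {S : Set (M' × M)} (hS : S.Finite) (hcard : S.ncard < Nat.card (A ⧸ P)) :
    ∃ C : Submodule A (M' × M), Nat.card C = Nat.card (A ⧸ P) ∧ ∀ c ∈ C, c ≠ 0 → c ∉ S := by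
  suffices h : ∃ a : A, ∀ c ∈ Submodule.span A {(e', a • e)}, c ≠ 0 → c ∉ S by
    obtain ⟨a, ha⟩ := h
    refine ⟨_, ?_, ha⟩
    have hker : LinearMap.ker (LinearMap.toSpanSingleton A (M' × M) (e', a • e)) = P := by
      ext f
      simp only [LinearMap.mem_ker, LinearMap.toSpanSingleton_apply, Prod.smul_mk, Prod.mk_eq_zero,
        he', smul_smul, he]
      exact ⟨And.left, fun h => ⟨h, P.mul_mem_right _ h⟩⟩
    rw [← LinearMap.range_toSpanSingleton]
    refine Nat.card_congr (Equiv.trans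
      (LinearMap.quotKerEquivRange (LinearMap.toSpanSingleton A (M' × M) (e', a • e))).toEquiv.symm
      (Submodule.quotEquivOfEq _ _ hker).toEquiv)
  by_contra! h
  have h' : ∀ a : A, ∃ f : A, f ∉ P ∧ (f • e', (f * a) • e) ∈ S := by
    intro a
    obtain ⟨c, hc, hc0, hcS⟩ := h a
    obtain ⟨f, rfl⟩ := Submodule.mem_span_singleton.1 hc
    refine ⟨f, fun hf => hc0 ?_, by simpa [smul_smul] using hcS⟩
    rw [Prod.smul_mk, smul_smul, (he' f).2 hf, (he _).2 (P.mul_mem_right a hf), Prod.mk_zero_zero]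
  choose f hfP hfS using h'
  -- The offending word attached to a class of `A ⧸ P` determines that class.
  have := hS.to_subtype
  refine hcard.not_ge (Nat.card_le_card_of_injective
    (fun x : A ⧸ P => (⟨_, hfS (Quotient.out x)⟩ : S)) fun x y hxy => ?_)
  obtain ⟨h1, h2⟩ := Prod.mk.inj (Subtype.mk.inj hxy)
  set a := Quotient.out x with ha
  set b := Quotient.out y with hb
  have h1' : f a - f b ∈ P := (he' _).1 (by rw [sub_smul, h1, sub_self])
  have h2' : f a * a - f b * b ∈ P := (he _).1 (by rw [sub_smul, h2, sub_self])
  have h3 : f a * (a - b) ∈ P := by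
    have : f a * (a - b) = (f a * a - f b * b) - (f a - f b) * b := by ring
    rw [this]
    exact P.sub_mem h2' (P.mul_mem_right _ h1')
  have h4 := (Ideal.IsPrime.mem_or_mem ‹_› h3).resolve_left (hfP a)
  have h5 := (Ideal.Quotient.eq (I := P)).2 h4
  rw [ha, hb] at h5
  rwa [← Quotient.out_eq x, ← Quotient.out_eq y]

/-! ### Counting words of small weight -/

namespace ConstacyclicRing

/-- The coefficients of the representative of degree less than `m`, as a vector indexed by `Fin m`.
The representative is computed as in `ConstacyclicRing.weight`. -/
noncomputable def coeffVec {R : Type*} [CommRing R] {a : R} {m : ℕ} (c : ConstacyclicRing a m) :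
    Fin m → R :=
  fun i => (Quotient.out c %ₘ (X ^ m - C a)).coeff i

variable {R : Type*} [CommRing R] [Nontrivial R] {a : R} {m : ℕ}

theorem degree_out_modByMonic_lt (hm : m ≠ 0) (c : ConstacyclicRing a m) :
    (Quotient.out c %ₘ (X ^ m - C a)).degree < m := by
  have h := degree_modByMonic_lt (Quotient.out c) (monic_X_pow_sub_C a hm)
  rwa [degree_X_pow_sub_C (Nat.pos_of_ne_zero hm)] at h

theorem coeffVec_injective (hm : m ≠ 0) :
    Function.Injective (coeffVec : ConstacyclicRing a m → Fin m → R) := by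
  intro c d hcd
  have h : Quotient.out c %ₘ (X ^ m - C a) = Quotient.out d %ₘ (X ^ m - C a) := by
    ext i
    rcases lt_or_ge i m with hi | hi
    · exact congrFun hcd ⟨i, hi⟩
    · rw [coeff_eq_zero_of_degree_lt ((degree_out_modByMonic_lt hm c).trans_le (mod_cast hi)),
        coeff_eq_zero_of_degree_lt ((degree_out_modByMonic_lt hm d).trans_le (mod_cast hi))]
  have hd : X ^ m - C a ∣ Quotient.out c - Quotient.out d := by
    rw [← modByMonic_eq_zero_iff_dvd (monic_X_pow_sub_C a hm), sub_modByMonic, h, sub_self]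
  have h5 := (Ideal.Quotient.eq (I := Ideal.span {X ^ m - C a})).2 (Ideal.mem_span_singleton.2 hd)
  rwa [← Quotient.out_eq c, ← Quotient.out_eq d]

theorem weight_eq_card_coeffVec [DecidableEq R] (hm : m ≠ 0) (c : ConstacyclicRing a m) :
    c.weight = (Finset.univ.filter fun i => coeffVec c i ≠ 0).card := by
  rw [weight, ← Finset.card_map Fin.valEmbedding]
  congr 1
  ext i
  simp only [mem_support_iff, Finset.mem_map, Finset.mem_filter, Finset.mem_univ, true_and,
    Fin.valEmbedding_apply]
  refine ⟨fun h => ⟨⟨i, ?_⟩, h, rfl⟩, ?_⟩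
  · by_contra! hi
    exact h (coeff_eq_zero_of_degree_lt ((degree_out_modByMonic_lt hm c).trans_le (mod_cast hi)))
  · rintro ⟨j, hj, rfl⟩
    exact hj

theorem finite [Finite R] (hm : m ≠ 0) : Finite (ConstacyclicRing a m) :=
  Finite.of_injective _ (coeffVec_injective hm)

/-- A bound for the weight enumerator: the sum over all vectors in `Fin m → R` factors over the
coordinates, each contributing `1 + (|R| - 1) x`. -/
theorem sum_pow_weight_le [Finite R] (hm : m ≠ 0) [Fintype (ConstacyclicRing a m)] {x : ℝ}
    (hx : 0 ≤ x) : ∑ c : ConstacyclicRing a m, x ^ c.weight ≤ (1 + Nat.card R * x) ^ m := by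
  classical
  have := Fintype.ofFinite R
  calc ∑ c : ConstacyclicRing a m, x ^ c.weight
      = ∑ c : ConstacyclicRing a m, ∏ i, (if coeffVec c i ≠ 0 then x else 1) := by
        refine Finset.sum_congr rfl fun c _ => ?_
        rw [weight_eq_card_coeffVec hm, Finset.prod_ite, Finset.prod_const, Finset.prod_const_one,
          mul_one]
    _ = ∑ v ∈ Finset.univ.map ⟨_, coeffVec_injective (a := a) hm⟩,
          ∏ i, (if v i ≠ 0 then x else 1) := by
        rw [Finset.sum_map]; rfl
    _ ≤ ∑ v : Fin m → R, ∏ i, (if v i ≠ 0 then x else 1) :=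
        Finset.sum_le_sum_of_subset_of_nonneg (Finset.subset_univ _) fun v _ _ =>
          Finset.prod_nonneg fun i _ => by split_ifs <;> positivity
    _ = (∑ r : R, if r ≠ 0 then x else 1) ^ m := by
        rw [← Fin.prod_const, Finset.prod_univ_sum, Fintype.piFinset_univ]
    _ ≤ (1 + Nat.card R * x) ^ m := by
        refine pow_le_pow_left₀ (Finset.sum_nonneg fun i _ => by split_ifs <;> positivity) ?_ m
        rw [← Finset.add_sum_erase _ _ (Finset.mem_univ (0 : R))]
        refine add_le_add (by simp) ?_
        calc _ ≤ ∑ r ∈ Finset.univ.erase (0 : R), x := Finset.sum_le_sum fun r hr => by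
              rw [if_pos (Finset.ne_of_mem_erase hr)]
          _ ≤ ∑ r : R, x := Finset.sum_le_sum_of_subset_of_nonneg (Finset.subset_univ _)
              fun _ _ _ => hx
          _ = Nat.card R * x := by simp [Nat.card_eq_fintype_card]

end ConstacyclicRing

/-! ### Roots of high degree over finite fields -/

theorem exists_extension_odd_prime_dvd_card_units (F : Type*) [Field F] [Finite F] :
    ∃ (E : Type) (_ : Field E) (_ : Finite E) (_ : Algebra F E) (r : ℕ), r.Prime ∧ r ≠ 2 ∧
      r ∣ Nat.card Eˣ := by
  obtain ⟨p, hp⟩ := CharP.exists F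
  have : Fact p.Prime := ⟨CharP.char_is_prime F p⟩
  obtain ⟨r, hr, hrp⟩ := Nat.exists_infinite_primes (Nat.card F + 3)
  -- By Fermat, `r` divides `q ^ (r - 1) - 1`, the order of the unit group in degree `r - 1`.
  have : NeZero (r - 1) := ⟨by omega⟩
  refine ⟨FiniteField.Extension F p (r - 1), inferInstance, inferInstance, inferInstance, r, hrp,
    by omega, ?_⟩
  rw [Nat.card_units, FiniteField.natCard_extension]
  have hcop : Nat.Coprime (Nat.card F) r :=
    (Nat.coprime_of_lt_prime Nat.card_pos.ne' (by omega) hrp).symm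
  have := Nat.ModEq.pow_totient hcop
  rw [Nat.totient_prime hrp] at this
  exact (Nat.modEq_iff_dvd' (Nat.one_le_pow _ _ Nat.card_pos)).1 this.symm

theorem pow_ne_generator {G : Type*} [Group G] [Finite G] {g : G}
    (hg : ∀ x, x ∈ Subgroup.zpowers g) {r : ℕ} (hr : r ≠ 1) (h : r ∣ Nat.card G) (b : G) :
    b ^ r ≠ g := by
  intro hb
  obtain ⟨k, hk⟩ := h
  have hk0 : k ≠ 0 := by rintro rfl; exact Nat.card_pos.ne' hk
  have h1 : g ^ k = 1 := by rw [← hb, ← pow_mul, ← hk, pow_card_eq_one']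
  have h2 := Nat.le_of_dvd (Nat.pos_of_ne_zero hk0) (orderOf_dvd_of_pow_eq_one h1)
  rw [orderOf_eq_card_of_forall_mem_zpowers hg, hk] at h2
  have h3 : r ≠ 0 := by rintro rfl; simp [Nat.card_pos.ne'] at hk
  have : 2 * k ≤ r * k := Nat.mul_le_mul_right k (by omega)
  omega

theorem exists_pow_eq_and_pow_eq {G : Type*} [Group G] [Finite G] {u : G} {a a' : ℕ}
    (hmod : a ≡ a' [MOD orderOf u]) (hcop : a.gcd (orderOf u) = 1) :
    ∃ v : G, v ^ a = u ∧ v ^ a' = u := by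
  obtain ⟨j, hj⟩ := exists_pow_eq_self_of_coprime (n := a) (x := u) hcop
  refine ⟨u ^ j, by rwa [← pow_mul, mul_comm, pow_mul], ?_⟩
  rw [← pow_mul, mul_comm, pow_mul, ← pow_eq_pow_iff_modEq.2 hmod, hj]

/-- Elements `b` of large degree over a finite field `F` with `b ^ (a n) = b ^ (a' n) = u`, for
`n = N r ^ i`: their degree is at least `n / N`, where `N` does not depend on `i`. -/
theorem exists_high_degree_root {F : Type*} [Field F] [Finite F] (u : Fˣ) {a a' : ℕ}
    (hmod : a ≡ a' [MOD orderOf u]) (hcop : a.gcd (orderOf u) = 1) :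
    ∃ N r : ℕ, 0 < N ∧ 1 < r ∧ ∀ i : ℕ, ∃ (K : Type) (_ : Field K) (_ : Algebra F K) (b : K),
      b ^ (a * (N * r ^ i)) = algebraMap F K u ∧ b ^ (a' * (N * r ^ i)) = algebraMap F K u ∧
      r ^ i ≤ (minpoly F b).natDegree ∧ IsIntegral F b := by
  obtain ⟨v, hv, hv'⟩ := exists_pow_eq_and_pow_eq hmod hcop
  obtain ⟨E, _, _, _, r, hr, hr2, hdvd⟩ := exists_extension_odd_prime_dvd_card_units F
  obtain ⟨g, hg⟩ := IsCyclic.exists_generator (α := Eˣ)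
  -- Adding `orderOf g` to the exponent makes it positive.
  obtain ⟨N, hN, hNv⟩ : ∃ N : ℕ, 0 < N ∧ g ^ N = Units.map (algebraMap F E : F →* E) v := by
    obtain ⟨N, hN⟩ := mem_powers_iff_mem_zpowers.2 (hg (Units.map (algebraMap F E : F →* E) v))
    refine ⟨N + orderOf g, by have := orderOf_pos g; omega, ?_⟩
    rw [pow_add, pow_orderOf_eq_one, mul_one]
    exact hN
  refine ⟨N, r, hN, hr.one_lt, fun i => ?_⟩
  have hirr : Irreducible (X ^ (r ^ i) - C (g : E)) := by
    refine X_pow_sub_C_irreducible_of_prime_pow hr hr2 i fun b hb => ?_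
    have hb0 : b ≠ 0 := by
      rintro rfl
      rw [zero_pow hr.ne_zero] at hb
      exact g.ne_zero hb.symm
    exact pow_ne_generator hg hr.ne_one hdvd (Units.mk0 b hb0) (Units.ext (by simpa using hb))
  have hpos : r ^ i ≠ 0 := pow_ne_zero _ hr.ne_zero
  have : Fact (Irreducible (X ^ (r ^ i) - C (g : E))) := ⟨hirr⟩
  let K := AdjoinRoot (X ^ (r ^ i) - C (g : E))
  let b : K := AdjoinRoot.root _
  have hb : b ^ (r ^ i) = algebraMap E K g := by
    have := AdjoinRoot.eval₂_root (X ^ (r ^ i) - C (g : E))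
    rw [eval₂_sub, eval₂_pow, eval₂_X, eval₂_C, sub_eq_zero] at this
    exact this
  have hbN : b ^ (N * r ^ i) = algebraMap F K v := by
    rw [mul_comm, pow_mul, hb, ← map_pow, IsScalarTower.algebraMap_apply F E K]
    congr 1
    simpa using congrArg Units.val hNv
  have : FiniteDimensional E K := (AdjoinRoot.powerBasis hirr.ne_zero).finite
  have : FiniteDimensional F E := Module.Finite.of_finite
  have : FiniteDimensional F K := FiniteDimensional.trans F E K
  have hint : IsIntegral F b := Algebra.IsIntegral.isIntegral b
  refine ⟨K, inferInstance, inferInstance, b, ?_, ?_, ?_, hint⟩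
  · rw [mul_comm, pow_mul, hbN, ← map_pow, ← Units.val_pow_eq_pow_val, hv]
  · rw [mul_comm, pow_mul, hbN, ← map_pow, ← Units.val_pow_eq_pow_val, hv']
  · have h1 : minpoly E b = X ^ (r ^ i) - C (g : E) := by
      have hmon := monic_X_pow_sub_C (g : E) hpos
      refine (minpoly.eq_of_irreducible_of_monic hirr ?_ hmon).symm
      simp [hb]
    have h2 := natDegree_le_of_dvd (minpoly.dvd_map_of_isScalarTower F E b)
      ((Polynomial.map_ne_zero_iff (algebraMap F E).injective).2 (minpoly.ne_zero hint))
    rwa [natDegree_map, h1, natDegree_X_pow_sub_C] at h2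

/-! ### Simple submodules of constacyclic rings -/

theorem natCard_quotient_ker_eval₂ {R F K : Type*} [CommRing R] [Field F] [Field K] [Algebra F K]
    {π : R →+* F} (hπ : Function.Surjective π) {b : K} (hb : IsIntegral F b) :
    Nat.card (R[X] ⧸ RingHom.ker (eval₂RingHom ((algebraMap F K).comp π) b)) =
      Nat.card F ^ (minpoly F b).natDegree := by
  set ψ := eval₂RingHom ((algebraMap F K).comp π) b with hψ
  have hψ' : ψ = (aeval b : F[X] →ₐ[F] K).toRingHom.comp (mapRingHom π) := by
    ext <;> simp [hψ]
  have hrange : (ψ.range : Set K) = Algebra.adjoin F {b} := by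
    rw [Algebra.adjoin_singleton_eq_range_aeval, hψ', RingHom.coe_range, RingHom.coe_comp,
      (show Function.Surjective (mapRingHom π) from map_surjective π hπ).range_comp]
    rfl
  have := Module.Finite.of_basis (Algebra.adjoin.powerBasis hb).basis
  calc _ = Nat.card ψ.range := Nat.card_congr (RingHom.quotientKerEquivRange ψ).toEquiv
    _ = Nat.card (Algebra.adjoin F {b}) := Nat.card_congr (Equiv.setCongr hrange)
    _ = _ := by
      rw [Module.natCard_eq_pow_finrank (K := F), (Algebra.adjoin.powerBasis hb).finrank,
        Algebra.adjoin.powerBasis_dim]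

/-- A root `b` of `X ^ m - a` in a field gives a ring homomorphism `S[X] / ⟨X ^ m - a⟩ → K`, whose
kernel is a prime of a finite ring and hence the annihilator of some element `e`. Over `R[X]`, the
annihilator of `e` is the kernel of evaluation at `b`. -/
theorem exists_smul_eq_zero_iff_mem_ker {R S K : Type*} [CommRing R] [CommRing S] [Nontrivial S]
    [Finite S] [Field K] (ρ : R →+* S) (τ : S →+* K) {a : S} {m : ℕ} (hm : m ≠ 0) {b : K}
    (hb : b ^ m = τ a) :
    ∃ e : ConstacyclicModule ρ a m, ∀ f : R[X],
      f • e = 0 ↔ f ∈ RingHom.ker (eval₂RingHom (τ.comp ρ) b) := by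
  have := ConstacyclicRing.finite (a := a) hm
  let φ : ConstacyclicRing a m →+* K := Ideal.Quotient.lift _ (eval₂RingHom τ b) (by
    intro p hp
    obtain ⟨h, rfl⟩ := Ideal.mem_span_singleton.1 hp
    simp [eval₂_sub, hb])
  have : (RingHom.ker φ).IsPrime := RingHom.ker_isPrime φ
  obtain ⟨e, he⟩ := exists_annihilator_eq_prime (ConstacyclicRing a m) (RingHom.ker φ)
  refine ⟨e, fun f => (he (Ideal.Quotient.mk _ (mapRingHom ρ f))).trans ?_⟩
  rw [RingHom.mem_ker, RingHom.mem_ker]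
  have : φ.comp ((Ideal.Quotient.mk _).comp (mapRingHom ρ)) = eval₂RingHom (τ.comp ρ) b := by
    ext <;> simp [φ]
  rw [← this]
  rfl

/-! ### Counting words in the double constacyclic space -/

namespace DoubleConstacyclicCode

/-- The Chernoff bound: each word of weight at most `W` contributes at least `1` to the sum of
`exp (s * (W - weight))` over all words, and this sum is controlled by the weight enumerators of the
two factors. -/
theorem ncard_wordWeight_le {R R' : Type*} [CommRing R] [CommRing R'] [Finite R] [Finite R']
    [Nontrivial R] [Nontrivial R'] {ρ : R →+* R'} {a : R} {α' α n : ℕ} (hm' : α' * n ≠ 0)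
    (hm : α * n ≠ 0) (W : ℝ) {s : ℝ} (hs : 0 ≤ s) :
    {c : DoubleConstacyclicSpace ρ a α' α n | (wordWeight c : ℝ) ≤ W}.Finite ∧
    ({c : DoubleConstacyclicSpace ρ a α' α n | (wordWeight c : ℝ) ≤ W}.ncard : ℝ) ≤
      Real.exp (s * W + (Nat.card R' * (α' * n) + Nat.card R * (α * n)) * Real.exp (-s)) := by
  classical
  have := ConstacyclicRing.finite (a := ρ a) hm'
  have := ConstacyclicRing.finite (a := a) hm
  have := Fintype.ofFinite (ConstacyclicRing (ρ a) (α' * n))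
  have := Fintype.ofFinite (ConstacyclicRing a (α * n))
  let V := ConstacyclicRing (ρ a) (α' * n) × ConstacyclicRing a (α * n)
  let T : Set V := {c | ((c.1.weight + c.2.weight : ℕ) : ℝ) ≤ W}
  change T.Finite ∧ (T.ncard : ℝ) ≤ _
  refine ⟨T.toFinite, ?_⟩
  have bound (q m : ℕ) : (1 + q * Real.exp (-s)) ^ m ≤ Real.exp (q * m * Real.exp (-s)) := by
    rw [show (q : ℝ) * m * Real.exp (-s) = m * (q * Real.exp (-s)) by ring, Real.exp_nat_mul]
    refine pow_le_pow_left₀ (by positivity) ?_ m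
    rw [add_comm]
    exact Real.add_one_le_exp _
  calc (T.ncard : ℝ) = ∑ c ∈ T.toFinset, (1 : ℝ) := by
        rw [Set.ncard_eq_toFinset_card', Finset.sum_const, nsmul_one]
    _ ≤ ∑ c ∈ T.toFinset, Real.exp (s * W) *
          (Real.exp (-s) ^ c.1.weight * Real.exp (-s) ^ c.2.weight) := by
        refine Finset.sum_le_sum fun c hc => ?_
        have hc' : ((c.1.weight + c.2.weight : ℕ) : ℝ) ≤ W := by simpa [T] using hc
        rw [← pow_add, ← Real.exp_nat_mul, ← Real.exp_add]
        refine Real.one_le_exp ?_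
        nlinarith [mul_le_mul_of_nonneg_left hc' hs]
    _ ≤ ∑ c : V, Real.exp (s * W) *
          (Real.exp (-s) ^ c.1.weight * Real.exp (-s) ^ c.2.weight) :=
        Finset.sum_le_sum_of_subset_of_nonneg (Finset.subset_univ _) fun _ _ _ => by positivity
    _ = Real.exp (s * W) * ((∑ c : ConstacyclicRing (ρ a) (α' * n), Real.exp (-s) ^ c.weight) *
          ∑ c : ConstacyclicRing a (α * n), Real.exp (-s) ^ c.weight) := by
        rw [← Finset.mul_sum, Fintype.sum_prod_type, Finset.sum_mul_sum]
    _ ≤ Real.exp (s * W) * (Real.exp (Nat.card R' * (α' * n : ℕ) * Real.exp (-s)) *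
          Real.exp (Nat.card R * (α * n : ℕ) * Real.exp (-s))) := by
        gcongr
        · exact (ConstacyclicRing.sum_pow_weight_le hm' (Real.exp_nonneg _)).trans (bound _ _)
        · exact (ConstacyclicRing.sum_pow_weight_le hm (Real.exp_nonneg _)).trans (bound _ _)
    _ = _ := by
        rw [← Real.exp_add, ← Real.exp_add]
        congr 1
        push_cast
        ring

end DoubleConstacyclicCode

/-! ### Good codes over finite chain rings -/

theorem radicalNilpotencyIndex_pos (R : Type*) [CommRing R] [h : IsFiniteChainRing R] :
    0 < radicalNilpotencyIndex R := by
  have := h.finite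
  have hnil : IsNilpotent (IsLocalRing.maximalIdeal R) := by
    rw [← IsLocalRing.jacobson_eq_maximalIdeal ⊥ bot_ne_top]
    exact IsArtinianRing.isNilpotent_jacobson_bot
  exact pos_nilpotencyClass_iff.2 hnil

/-- The residue map of `R` factors through `ρ`, as the kernel of `ρ` consists of nonunits; this
makes the residue field of `R` serve for `R'` too. -/
theorem exists_residue_comp_eq {R R' : Type*} [CommRing R] [CommRing R'] [IsLocalRing R]
    [Nontrivial R'] {ρ : R →+* R'} (hρ : Function.Surjective ρ) :
    ∃ σ : R' →+* IsLocalRing.ResidueField R, σ.comp ρ = IsLocalRing.residue R := by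
  refine ⟨(Ideal.Quotient.lift (RingHom.ker ρ) (IsLocalRing.residue R) fun x hx => ?_).comp
    (RingHom.quotientKerEquivOfSurjective hρ).symm.toRingHom, ?_⟩
  · rw [IsLocalRing.residue_eq_zero_iff, IsLocalRing.mem_maximalIdeal, mem_nonunits_iff]
    intro hu
    exact not_isUnit_zero ((RingHom.mem_ker.1 hx) ▸ hu.map ρ)
  · ext x
    have : (RingHom.quotientKerEquivOfSurjective hρ).symm (ρ x) = Ideal.Quotient.mk _ x := by
      rw [RingEquiv.symm_apply_eq]; rfl
    simp [this]

/-- A common root `b` of the two moduli with degree at least `D` yields a code of `q`-dimension at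
least `D` and minimum weight at least `D / (4 s)`, where `s` is any parameter for which the Chernoff
bound leaves fewer than `2 ^ D` words of weight at most `D / (4 s)`. -/
theorem exists_code_of_root {R R' : Type*} [CommRing R] [CommRing R'] [hR : IsFiniteChainRing R]
    [hR' : IsFiniteChainRing R'] {ρ : R →+* R'} (hρ : Function.Surjective ρ) {a : R}
    {α α' n D : ℕ} (hm : α * n ≠ 0) (hm' : α' * n ≠ 0) {K : Type*} [Field K]
    [Algebra (IsLocalRing.ResidueField R) K] {b : K}
    (hb : b ^ (α * n) = algebraMap _ K (IsLocalRing.residue R a))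
    (hb' : b ^ (α' * n) = algebraMap _ K (IsLocalRing.residue R a))
    (hint : IsIntegral (IsLocalRing.ResidueField R) b)
    (hD : D ≤ (minpoly (IsLocalRing.ResidueField R) b).natDegree) (hD0 : D ≠ 0) {s : ℝ}
    (hs : 0 < s)
    (hexp : (Nat.card R' * (α' * n) + Nat.card R * (α * n)) * Real.exp (-s) ≤ D / 4) :
    ∃ C : DoubleConstacyclicCode ρ a α' α n,
      (D : ℝ) ≤ Real.logb (Nat.card (IsLocalRing.ResidueField R)) (Nat.card C) ∧
      D / (4 * s) ≤ (DoubleConstacyclicCode.minWeight C : ℝ) := by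
  have := hR.finite
  have := hR'.finite
  have := hR.nontrivial
  have := hR'.nontrivial
  have : Finite (IsLocalRing.ResidueField R) :=
    Finite.of_surjective _ (IsLocalRing.residue_surjective (R := R))
  have hq : 2 ≤ Nat.card (IsLocalRing.ResidueField R) := Finite.one_lt_card
  obtain ⟨σ, hσ⟩ := exists_residue_comp_eq hρ
  set P := RingHom.ker (eval₂RingHom ((algebraMap (IsLocalRing.ResidueField R) K).comp
    (IsLocalRing.residue R)) b) with hP
  have : P.IsPrime := RingHom.ker_isPrime _
  have hPcard : Nat.card (R[X] ⧸ P) = _ :=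
    natCard_quotient_ker_eval₂ (IsLocalRing.residue_surjective (R := R)) hint
  obtain ⟨e', he'⟩ := exists_smul_eq_zero_iff_mem_ker ρ
    ((algebraMap (IsLocalRing.ResidueField R) K).comp σ) (a := ρ a) hm' (b := b)
    (by rw [hb', ← hσ]; rfl)
  rw [RingHom.comp_assoc, hσ, ← hP] at he'
  obtain ⟨e, he⟩ : ∃ e : ConstacyclicRing a (α * n), ∀ f : R[X], f • e = 0 ↔ f ∈ P := by
    obtain ⟨e, he⟩ := exists_smul_eq_zero_iff_mem_ker (RingHom.id R)
      ((algebraMap (IsLocalRing.ResidueField R) K).comp (IsLocalRing.residue R)) (a := a) hm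
      (b := b) hb
    rw [RingHom.comp_id, ← hP] at he
    refine ⟨e, fun f => (Iff.of_eq (congrArg (· = 0) ?_)).trans (he f)⟩
    change Ideal.Quotient.mk _ f * e = Ideal.Quotient.mk _ (mapRingHom (RingHom.id R) f) * e
    rw [mapRingHom_id, RingHom.id_apply]
  obtain ⟨hfin, hcount⟩ := DoubleConstacyclicCode.ncard_wordWeight_le (ρ := ρ) (a := a) hm' hm
    (D / (4 * s)) hs.le
  have hpow : Nat.card (IsLocalRing.ResidueField R) ^ D ≤ Nat.card (R[X] ⧸ P) :=
    hPcard ▸ Nat.pow_le_pow_right (by omega) hD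
  -- Both halves of the exponent are at most `D / 4`, and `exp (1 / 2) < 2`.
  have hlt : Real.exp (s * (D / (4 * s)) +
      (Nat.card R' * (α' * n) + Nat.card R * (α * n)) * Real.exp (-s)) < (2 : ℝ) ^ D := by
    have h1 : s * (D / (4 * s)) = D / 4 := by field_simp
    have h2 : Real.exp (1 / 2) < 2 := by
      rw [← Real.lt_log_iff_exp_lt two_pos]
      linarith [Real.log_two_gt_d9]
    calc _ ≤ Real.exp (D * (1 / 2)) := Real.exp_le_exp.2 (by rw [h1]; linarith)
      _ = Real.exp (1 / 2) ^ D := Real.exp_nat_mul _ _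
      _ < 2 ^ D := pow_lt_pow_left₀ h2 (Real.exp_nonneg _) hD0
  have hcard := Nat.cast_lt.1 ((hcount.trans_lt hlt).trans_le
    (show (2 : ℝ) ^ D ≤ (Nat.card (R[X] ⧸ P) : ℕ) from
      mod_cast (Nat.pow_le_pow_left hq D).trans hpow))
  obtain ⟨C, hC, hCS⟩ := exists_submodule_disjoint_of_ncard_lt P he' he hfin hcard
  refine ⟨C, ?_, ?_⟩
  · rw [hC, Real.le_logb_iff_rpow_le (mod_cast hq) (by rw [hPcard]; positivity), Real.rpow_natCast]
    exact mod_cast hpow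
  · have hone : 1 < Nat.card C := by
      rw [hC]
      exact (Nat.one_lt_pow hD0 hq).trans_le hpow
    have : Finite C := Nat.finite_of_card_ne_zero (by omega)
    have : Nontrivial C := Finite.one_lt_card_iff_nontrivial.1 hone
    obtain ⟨⟨c, hc⟩, hc0⟩ := exists_ne (0 : C)
    have hne : {w : ℕ | ∃ c ∈ C, c ≠ 0 ∧ DoubleConstacyclicCode.wordWeight c = w}.Nonempty :=
      ⟨_, c, hc, fun h => hc0 (Subtype.ext h), rfl⟩
    obtain ⟨d, hd, hd0, hdw⟩ := Nat.sInf_mem hne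
    rw [DoubleConstacyclicCode.minWeight, ← hdw]
    exact (not_le.1 (hCS d hd hd0)).le

theorem theorem1p1 {R R' : Type*} [CommRing R] [CommRing R'] [IsFiniteChainRing R]
    [IsFiniteChainRing R'] (ρ : R →+* R') (hρ : Function.Surjective ρ) (lam : Rˣ)
    (α α' : ℕ) (hα : 0 < α) (hα' : 0 < α') (hmod : α ≡ α' [MOD residueOrder lam])
    (hcop : Nat.gcd α (residueOrder lam) = 1) :
    ∃ (n : ℕ → ℕ) (C : ∀ i, DoubleConstacyclicCode ρ (lam : R) α' α (n i)),
      (∀ i, 0 < n i) ∧ DoubleConstacyclicCode.AsymptoticallyGood C := by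
  have := IsFiniteChainRing.finite (R := R)
  have := IsFiniteChainRing.finite (R := R')
  have : Finite (IsLocalRing.ResidueField R) :=
    Finite.of_surjective _ (IsLocalRing.residue_surjective (R := R))
  obtain ⟨N, r, hN, hr, h⟩ := exists_high_degree_root
    (Units.map (IsLocalRing.residue R : R →* IsLocalRing.ResidueField R) lam) hmod hcop
  have hpos (i : ℕ) : 0 < r ^ i := pow_pos (by omega) i
  have hn (i : ℕ) : 0 < N * r ^ i := Nat.mul_pos hN (hpos i)
  -- With `s = log y`, the second term of the Chernoff exponent is exactly `r ^ i / 4`.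
  set y : ℝ := 4 * N * (Nat.card R' * α' + Nat.card R * α) with hy
  have hy1 : 1 < y := by
    have : 1 ≤ N * (Nat.card R' * α' + Nat.card R * α) :=
      Nat.mul_pos hN (Nat.add_pos_left (Nat.mul_pos Nat.card_pos hα') _)
    have : (1 : ℝ) ≤ N * (Nat.card R' * α' + Nat.card R * α) := mod_cast this
    rw [hy]
    linarith
  have hs : 0 < Real.log y := Real.log_pos hy1
  have hcode (i : ℕ) : ∃ C : DoubleConstacyclicCode ρ (lam : R) α' α (N * r ^ i),
      ((r ^ i : ℕ) : ℝ) ≤ Real.logb (Nat.card (IsLocalRing.ResidueField R)) (Nat.card C) ∧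
      (r ^ i : ℕ) / (4 * Real.log y) ≤ (DoubleConstacyclicCode.minWeight C : ℝ) := by
    obtain ⟨K, _, _, b, hb, hb', hdeg, hint⟩ := h i
    refine exists_code_of_root hρ (Nat.mul_pos hα (hn i)).ne' (Nat.mul_pos hα' (hn i)).ne' hb hb'
      hint hdeg (hpos i).ne' hs (le_of_eq ?_)
    rw [Real.exp_neg, Real.exp_log (by linarith)]
    have hy0 : y ≠ 0 := by linarith
    rw [mul_inv_eq_iff_eq_mul₀ hy0, hy]
    push_cast
    ring
  choose C hrate hdist using hcode
  set L : ℕ := α' * radicalNilpotencyIndex R' + α * radicalNilpotencyIndex R with hL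
  have hL0 : 0 < L := Nat.add_pos_right _ (Nat.mul_pos hα (radicalNilpotencyIndex_pos R))
  have hlen (i : ℕ) :
      DoubleConstacyclicCode.codeLength R R' α' α (N * r ^ i) = N * L * r ^ i := by
    rw [DoubleConstacyclicCode.codeLength, hL]
    ring
  refine ⟨fun i => N * r ^ i, C, hn, ?_, min (1 / (N * L)) (1 / (4 * Real.log y) / (N * L)),
    by positivity, fun i => ⟨?_, ?_⟩⟩
  · refine tendsto_atTop_mono (fun i => ?_) tendsto_id
    rw [hlen]
    exact (Nat.lt_pow_self hr).le.trans (Nat.le_mul_of_pos_left _ (Nat.mul_pos hN hL0))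
  · have hri : (0 : ℝ) < (r ^ i : ℕ) := mod_cast hpos i
    refine (min_le_left _ _).trans ?_
    rw [DoubleConstacyclicCode.rate, hlen, Nat.cast_mul (N * L), Nat.cast_mul N,
      le_div_iff₀ (by positivity)]
    refine le_trans (le_of_eq ?_) (hrate i)
    field_simp
  · have hri : (0 : ℝ) < (r ^ i : ℕ) := mod_cast hpos i
    refine (min_le_right _ _).trans ?_
    rw [DoubleConstacyclicCode.relMinDistance, hlen, Nat.cast_mul (N * L), Nat.cast_mul N,
      le_div_iff₀ (by positivity)]
    refine le_trans (le_of_eq ?_) (hdist i)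
    field_simp
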